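/- Assume the Continuum Hypothesis, $2^{\aleph_0}=\aleph_1$. All spaces are $T_3$ (regular and $T_1$). Call a space $X$ productively Lindelöf if $X\times Y$ is Lindelöf for every Lindelöf ($T_3$) space $Y$. Then every productively Lindelöf space $X$ is Menger, i.e. for every sequence $(\mathcal U_n)_{n<\omega}$ of open covers of $X$ there are finite $\mathcal V_n\subseteq\mathcal U_n$ such that $\bigcup_{n<\omega}\mathcal V_n$ covers $X$; and hence $X$ is a D-space, i.e. whenever an open set $f(x)\ni x$ is assigned to each $x\in X$, there is a closed discrete set $D\subseteq X$ with $\bigcup_{x\in D}f(x)=X$. -/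

import Mathlib

universe u

/-- A `T₃` space `X` is productively Lindelöf if `X × Y` is Lindelöf for every Lindelöf `T₃`
space `Y`. -/
def ProductivelyLindelof (X : Type u) [TopologicalSpace X] : Prop :=
  ∀ (Y : Type u) [TopologicalSpace Y] [T3Space Y] [LindelofSpace Y], LindelofSpace (X × Y)

/-- `𝒰` is an open cover of `X`. -/
def IsOpenCovering {X : Type u} [TopologicalSpace X] (𝒰 : Set (Set X)) : Prop :=
  (∀ U ∈ 𝒰, IsOpen U) ∧ ⋃₀ 𝒰 = Set.univ

/-- `X` is Menger: from every sequence of open covers one can choose finite subfamilies which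
together cover `X`. -/
def IsMengerSpace (X : Type u) [TopologicalSpace X] : Prop :=
  ∀ 𝒰 : ℕ → Set (Set X), (∀ n, IsOpenCovering (𝒰 n)) →
    ∃ 𝒱 : ℕ → Set (Set X), (∀ n, 𝒱 n ⊆ 𝒰 n ∧ (𝒱 n).Finite) ∧ ⋃₀ (⋃ n, 𝒱 n) = Set.univ

/-- `X` is a D-space: for every open neighborhood assignment `f` there is a closed discrete
`D ⊆ X` with `⋃ {f x : x ∈ D} = X`. -/
def IsDSpace (X : Type u) [TopologicalSpace X] : Prop :=
  ∀ f : X → TopologicalSpace.Opens X, (∀ x, x ∈ f x) →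
    ∃ D : Set X, IsClosed D ∧ DiscreteTopology D ∧ ⋃ x ∈ D, (f x : Set X) = Set.univ

open Set Filter Topology

/-! If a sequence of covers defeats every finite selection, cozero refinements map `X` by a
continuous `Φ` into the set G of points of a cube having an entry other than 1 in every row. Each
compact subset of G lies in some `boundedRows b`. CH lists the bounds in type ω₁, and failure of
selection gives points `x i` with `Φ (x i)` outside the sets of all bounds up to `i`. Every open set
around E, the complement of G, then contains all but countably many `Φ (x i)`, so isolating these
over E yields a Lindelöf Michael-type space whose product with `X` is not Lindelöf. For the
D-property, a Menger-game strategy covers the space by values of `f` at finitely many new points per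
round; a branch defeating it gives `D`. -/

/-! ### The Menger game -/

theorem IsMengerSpace.exists_bound {X : Type u} [TopologicalSpace X] (hX : IsMengerSpace X)
    {p : ℕ → X → ℕ} (hp : ∀ n x, ∀ᶠ y in 𝓝 x, p n y ≤ p n x) :
    ∃ g : ℕ → ℕ, ∀ x, ∃ n, p n x ≤ g n := by
  -- Sublevel sets increase with `j`, so a finite subfamily lies in a single one.
  obtain ⟨𝒱, h𝒱, hcov⟩ := hX (fun n => range fun j => {x | p n x ≤ j}) fun n => by
    refine ⟨?_, ?_⟩
    · rintro _ ⟨j, rfl⟩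
      refine isOpen_iff_mem_nhds.2 fun x hx => ?_
      filter_upwards [hp n x] with y hy
      exact hy.trans hx
    · exact eq_univ_of_forall fun x => ⟨_, ⟨p n x, rfl⟩, le_refl (p n x)⟩
  have hb : ∀ n, ∃ b, ∀ V ∈ 𝒱 n, V ⊆ {x | p n x ≤ b} := by
    intro n
    choose! j hj using (h𝒱 n).1
    obtain ⟨b, hb⟩ := ((h𝒱 n).2.image j).bddAbove
    refine ⟨b, fun V hV x hx => ?_⟩
    rw [← hj hV] at hx
    exact le_trans hx (hb (mem_image_of_mem j hV))
  choose g hg using hb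
  refine ⟨g, fun x => ?_⟩
  obtain ⟨V, hV, hx⟩ := hcov.ge (mem_univ x)
  obtain ⟨n, hn⟩ := mem_iUnion.1 hV
  exact ⟨n, hg n V hn hx⟩

/-- The lists of length `n` with entries at most `k`. -/
def boundedLists : ℕ → ℕ → Finset (List ℕ)
  | 0, _ => {[]}
  | n + 1, k => (Finset.range (k + 1) ×ˢ boundedLists n k).image fun p => p.1 :: p.2

theorem mem_boundedLists {n k : ℕ} {σ : List ℕ} :
    σ ∈ boundedLists n k ↔ σ.length = n ∧ ∀ a ∈ σ, a ≤ k := by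
  induction n generalizing σ with
  | zero => cases σ <;> simp [boundedLists]
  | succ n ih => cases σ <;> simp [boundedLists, ih]; tauto

/-- A bound, independent of the branch, for the branches that stay below `h` at every node. -/
def escapeBound (h : List ℕ → ℕ) : ℕ → ℕ
  | 0 => h []
  | n + 1 => max (escapeBound h n) ((boundedLists (n + 1) (escapeBound h n)).sup h)

/-- The node of length `n` on the branch `g`, with the last entry first. -/
def branchNode (g : ℕ → ℕ) : ℕ → List ℕ
  | 0 => []
  | n + 1 => g n :: branchNode g n

theorem length_branchNode (g : ℕ → ℕ) (n : ℕ) : (branchNode g n).length = n := by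
  induction n with
  | zero => rfl
  | succ n ih => simp [branchNode, ih]

theorem lt_escapeBound {h : List ℕ → ℕ} {g : ℕ → ℕ} (hg : ∀ n, g n < h (branchNode g n)) (n : ℕ) :
    g n < escapeBound h n ∧ ∀ a ∈ branchNode g (n + 1), a ≤ escapeBound h n := by
  induction n with
  | zero => simpa [branchNode, escapeBound] using ⟨hg 0, (hg 0).le⟩
  | succ n ih =>
    have hlt : g (n + 1) < escapeBound h (n + 1) :=
      (hg (n + 1)).trans_le <| le_max_of_le_right <|
        Finset.le_sup (f := h) (mem_boundedLists.2 ⟨length_branchNode _ _, ih.2⟩)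
    refine ⟨hlt, fun a ha => ?_⟩
    rcases List.mem_cons.1 ha with rfl | ha
    · exact hlt.le
    · exact (ih.2 a ha).trans (le_max_left _ _)

/-- Each bound involves only finitely many nodes, and for `y` near `x` the nodes used for `y` are
among those used for `x`. -/
theorem eventually_escapeBound_le {X : Type u} [TopologicalSpace X] {h : X → List ℕ → ℕ}
    (hh : ∀ σ x, ∀ᶠ y in 𝓝 x, h y σ ≤ h x σ) (n : ℕ) (x : X) :
    ∀ᶠ y in 𝓝 x, escapeBound (h y) n ≤ escapeBound (h x) n := by
  induction n with
  | zero => exact hh [] x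
  | succ n ih =>
    have hfin : ∀ᶠ y in 𝓝 x, ∀ σ ∈ boundedLists (n + 1) (escapeBound (h x) n), h y σ ≤ h x σ :=
      (Finset.eventually_all _).2 fun σ _ => hh σ x
    filter_upwards [ih, hfin] with y hy hfy
    refine max_le_max hy (Finset.sup_le fun σ hσ => ?_)
    obtain ⟨hl, hb⟩ := mem_boundedLists.1 hσ
    have hσ' : σ ∈ boundedLists (n + 1) (escapeBound (h x) n) :=
      mem_boundedLists.2 ⟨hl, fun a ha => (hb a ha).trans hy⟩
    exact (hfy σ hσ').trans (Finset.le_sup hσ')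

/-- Hurewicz's theorem on the Menger game: for a strategy of the first player given by
increasing covers indexed by `ℕ`, some branch defeats it. -/
theorem IsMengerSpace.exists_branch {X : Type u} [TopologicalSpace X] (hX : IsMengerSpace X)
    {h : X → List ℕ → ℕ} (hh : ∀ σ x, ∀ᶠ y in 𝓝 x, h y σ ≤ h x σ) :
    ∃ g : ℕ → ℕ, ∀ x, ∃ n, h x (branchNode g n) ≤ g n := by
  obtain ⟨g, hg⟩ := hX.exists_bound fun n x => eventually_escapeBound_le hh n x
  refine ⟨g, fun x => ?_⟩
  by_contra! hx
  obtain ⟨n, hn⟩ := hg x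
  exact (lt_escapeBound hx n).1.not_ge hn

/-! ### D-spaces -/

theorem isClosed_and_discreteTopology_of_locally_finite {X : Type u} [TopologicalSpace X]
    [T1Space X] {D : Set X} (hD : ∀ x, ∃ N ∈ 𝓝 x, (N ∩ D).Finite) :
    IsClosed D ∧ DiscreteTopology D := by
  have key : IsClosed D ∧ IsDiscrete D := by
    refine isClosed_and_discrete_iff.2 fun x => ?_
    obtain ⟨N, hN, hfin⟩ := hD x
    rw [disjoint_principal_right]
    have hc : ((N ∩ D) \ {x})ᶜ ∈ 𝓝 x :=
      (hfin.subset sdiff_subset).isClosed.isOpen_compl.mem_nhds (by simp)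
    filter_upwards [mem_nhdsWithin_of_mem_nhds hN, mem_nhdsWithin_of_mem_nhds hc,
      self_mem_nhdsWithin] with y h1 h2 h3 h4
    exact h2 ⟨⟨h1, h4⟩, h3⟩
  exact ⟨key.1, isDiscrete_iff_discreteTopology.1 key.2⟩

/-- Every open set `W` of a Lindelöf space can be completed to a cover by countably many values of
a neighborhood assignment, taken at points outside `W`. -/
theorem exists_seq_cover_compl {X : Type u} [TopologicalSpace X] [LindelofSpace X]
    {f : X → TopologicalSpace.Opens X} (hf : ∀ x, x ∈ f x) (W : TopologicalSpace.Opens X) :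
    ∃ A : ℕ → Set X, (∀ k, (A k).Finite ∧ Disjoint (A k) W) ∧ Monotone A ∧
      ∀ x, ∃ k, x ∈ (W : Set X) ∪ ⋃ a ∈ A k, f a := by
  obtain ⟨t, htc, htW, hcov⟩ := (W.isOpen.isClosed_compl.isLindelof).elim_nhds_subcover
    (fun x => (f x : Set X)) fun x _ => (f x).isOpen.mem_nhds (hf x)
  obtain ⟨e, he⟩ := countable_iff_exists_injOn.1 htc
  refine ⟨fun k => {a ∈ t | e a ≤ k}, fun k => ⟨?_, ?_⟩, ?_, fun x => ?_⟩
  · refine Finite.of_finite_image ((finite_Iic k).subset ?_) (he.mono fun a ha => ha.1)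
    rintro _ ⟨a, ha, rfl⟩
    exact ha.2
  · exact disjoint_left.2 fun a ha => htW a ha.1
  · exact fun k l hkl a ha => ⟨ha.1, ha.2.trans hkl⟩
  · by_cases hx : x ∈ (W : Set X)
    · exact ⟨0, Or.inl hx⟩
    · obtain ⟨a, ha, hxa⟩ := mem_iUnion₂.1 (hcov hx)
      exact ⟨e a, Or.inr (mem_iUnion₂.2 ⟨a, ⟨ha, le_rfl⟩, hxa⟩)⟩

/-- Aurichi's theorem: Lindelöf (which Menger implies) Menger `T₁` spaces are D-spaces. -/
theorem IsMengerSpace.isDSpace {X : Type u} [TopologicalSpace X] [T1Space X] [LindelofSpace X]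
    (hX : IsMengerSpace X) : IsDSpace X := by
  intro f hf
  choose A hA hmono hcov using exists_seq_cover_compl hf
  let step (W : TopologicalSpace.Opens X) (k : ℕ) : TopologicalSpace.Opens X :=
    W ⊔ ⨆ a ∈ A W k, f a
  let W : List ℕ → TopologicalSpace.Opens X := List.foldr (fun k W => step W k) ⊥
  have hstep : ∀ V k x, x ∈ step V k ↔ x ∈ V ∨ ∃ a ∈ A V k, x ∈ f a := fun V k x => by
    simp [step, ← SetLike.mem_coe]
  have hex : ∀ x V, ∃ k, x ∈ step V k := fun x V => by
    obtain ⟨k, hk⟩ := hcov V x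
    refine ⟨k, (hstep _ _ _).2 ?_⟩
    simpa using hk
  have hstep_mono : ∀ V {k l x}, k ≤ l → x ∈ step V k → x ∈ step V l := by
    intro V k l x hkl hx
    rw [hstep] at hx ⊢
    exact hx.imp_right fun ⟨a, ha, hxa⟩ => ⟨a, hmono V hkl ha, hxa⟩
  classical
  -- The strategy value is the least `k` whose step captures `x`; that step is open, hence captures
  -- nearby points too.
  obtain ⟨g, hg⟩ := hX.exists_branch (h := fun x σ => Nat.find (hex x (W σ))) fun σ x => by
    filter_upwards [(step (W σ) _).isOpen.mem_nhds (Nat.find_spec (hex x (W σ)))] with y hy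
    exact Nat.find_min' _ hy
  let B : ℕ → Set X := fun n => A (W (branchNode g n)) (g n)
  have hWsucc : ∀ n, W (branchNode g (n + 1)) = step (W (branchNode g n)) (g n) := fun n => rfl
  have hWmono : Monotone fun n => W (branchNode g n) :=
    monotone_nat_of_le_succ fun n => by rw [hWsucc]; exact le_sup_left
  have hxW : ∀ x, ∃ n, x ∈ W (branchNode g n) := fun x => by
    obtain ⟨n, hn⟩ := hg x
    exact ⟨n + 1, by rw [hWsucc]; exact hstep_mono _ hn (Nat.find_spec (hex x _))⟩
  have hWB : ∀ n x, x ∈ W (branchNode g n) → ∃ m, ∃ a ∈ B m, x ∈ f a := by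
    intro n x
    induction n with
    | zero => exact fun hx => hx.elim
    | succ n ih =>
      rw [hWsucc, hstep]
      rintro (hx | ⟨a, ha, hxa⟩)
      · exact ih hx
      · exact ⟨n, a, ha, hxa⟩
  -- Points chosen at stage `n` or later avoid the open set reached at stage `n`, so that set meets
  -- `D` in a finite set.
  have hDdisc := isClosed_and_discreteTopology_of_locally_finite (D := ⋃ n, B n) fun x => by
    obtain ⟨n, hn⟩ := hxW x
    refine ⟨_, (W (branchNode g n)).isOpen.mem_nhds hn,
      ((finite_lt_nat n).biUnion fun m _ => (hA _ _).1 : (⋃ m ∈ {m | m < n}, B m).Finite).subset ?_⟩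
    rintro y ⟨hyW, hyD⟩
    obtain ⟨m, hm⟩ := mem_iUnion.1 hyD
    refine mem_iUnion₂.2 ⟨m, ?_, hm⟩
    by_contra hmn
    exact disjoint_left.1 (hA _ _).2 hm (hWmono (not_lt.1 hmn) hyW)
  refine ⟨⋃ n, B n, hDdisc.1, hDdisc.2, eq_univ_of_forall fun x => ?_⟩
  obtain ⟨n, hn⟩ := hxW x
  obtain ⟨m, a, ha, hxa⟩ := hWB n x hn
  exact mem_iUnion₂.2 ⟨a, mem_iUnion.2 ⟨m, ha⟩, hxa⟩

/-! ### Michael-type spaces -/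

theorem isLindelof_of_countable_diff {X : Type u} [TopologicalSpace X] {A Z : Set X}
    (hA : IsLindelof A) (hZ : ∀ O, IsOpen O → A ⊆ O → (Z \ O).Countable) (hAZ : A ⊆ Z) :
    IsLindelof Z := by
  refine isLindelof_of_countable_subcover fun {ι} U hU hcov => ?_
  obtain ⟨t, htc, ht⟩ := hA.elim_countable_subcover U hU (hAZ.trans hcov)
  have hc := hZ (⋃ i ∈ t, U i) (isOpen_biUnion fun i _ => hU i) ht
  obtain ⟨s, hsc, hs⟩ := hc.isLindelof.elim_countable_subcover U hU (sdiff_subset.trans hcov)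
  refine ⟨t ∪ s, htc.union hsc, fun z hz => ?_⟩
  rw [biUnion_union]
  by_cases h : z ∈ ⋃ i ∈ t, U i
  · exact Or.inl h
  · exact Or.inr (hs ⟨hz, h⟩)

/-- The Michael-type set in `K × OnePoint I`: the points of `E`, together with isolated points
indexed by `I` lying over the points `y i`. -/
def michaelSet {K I : Type*} (E : Set K) (y : I → K) : Set (K × OnePoint I) :=
  (fun k => (k, OnePoint.infty)) '' E ∪ range fun i => (y i, (i : OnePoint I))

/-- Near each point of `E`, an open set around the copy of `E` at infinity omits only finitely many
indices; countably many such neighborhoods cover `E`, and `hy` handles the `y i` outside them. -/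
theorem isLindelof_michaelSet {K I : Type*} [TopologicalSpace K] [SecondCountableTopology K]
    [TopologicalSpace I] [DiscreteTopology I] {E : Set K} {y : I → K}
    (hy : ∀ U, IsOpen U → E ⊆ U → {i | y i ∉ U}.Countable) : IsLindelof (michaelSet E y) := by
  have hE : IsLindelof E := HereditarilyLindelofSpace.isLindelof E
  refine isLindelof_of_countable_diff (hE.image (f := fun k => (k, OnePoint.infty)) (by fun_prop))
    (fun O hO hEO => ?_) subset_union_left
  have hloc : ∀ k ∈ E, ∃ U ∈ 𝓝 k, ∃ F : Set I, F.Finite ∧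
      ∀ k' ∈ U, ∀ i ∉ F, (k', (i : OnePoint I)) ∈ O := by
    intro k hk
    obtain ⟨U, hU, V, hV, hUV⟩ :=
      mem_nhds_prod_iff.1 (hO.mem_nhds (hEO (mem_image_of_mem _ hk)))
    obtain ⟨F, hF, hFV⟩ := OnePoint.hasBasis_nhds_infty.mem_iff.1 hV
    exact ⟨U, hU, F, hF.2.finite_of_discrete, fun k' hk' i hi =>
      hUV ⟨hk', hFV (Or.inl (mem_image_of_mem _ hi))⟩⟩
  choose! U hU F hF hUF using hloc
  obtain ⟨t, htc, htE, hcov⟩ := hE.elim_nhds_subcover (fun k => interior (U k))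
    fun k hk => interior_mem_nhds.2 (hU k hk)
  have hbad := (hy _ (isOpen_biUnion fun k _ => isOpen_interior) hcov).union
    (htc.biUnion fun k hk => (hF k (htE k hk)).countable)
  refine (hbad.image fun i => (y i, (i : OnePoint I))).mono ?_
  rintro z ⟨hz | ⟨i, rfl⟩, hzO⟩
  · exact (hzO (hEO hz)).elim
  · refine mem_image_of_mem _ ?_
    by_contra hi
    rw [mem_union, not_or, mem_ofPred_eq, not_not] at hi
    obtain ⟨k, hk, hyk⟩ := mem_iUnion₂.1 hi.1
    exact hzO (hUF k (htE k hk) _ (interior_subset hyk) i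
      fun h => hi.2 (mem_biUnion hk h))

/-- A space which maps into the complement of `E` so as to hit every `y i` has a non-Lindelöf
product with the Michael-type space of `E` and `y`, unless the index set is countable. -/
theorem countable_of_productivelyLindelof {X : Type u} [TopologicalSpace X]
    (hX : ProductivelyLindelof X) {K I : Type} [TopologicalSpace K] [T3Space K]
    [SecondCountableTopology K] [TopologicalSpace I] [DiscreteTopology I] {E : Set K} {Φ : X → K}
    (hΦ : Continuous Φ) (hΦE : ∀ x, Φ x ∉ E) (x : I → X)
    (hx : ∀ U, IsOpen U → E ⊆ U → {i | Φ (x i) ∉ U}.Countable) : Countable I := by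
  let Z := michaelSet E fun i => Φ (x i)
  have : LindelofSpace Z := isLindelof_iff_lindelofSpace.1 (isLindelof_michaelSet hx)
  have : LindelofSpace (ULift.{u} Z) := Homeomorph.ulift.isClosedEmbedding.LindelofSpace
  have : LindelofSpace (X × ULift.{u} Z) := hX _
  let q (p : X × ULift.{u} Z) : K × OnePoint I := p.2.down
  have hq : Continuous q := by fun_prop
  -- Since `Φ` avoids `E`, this closed set meets only the isolated points; it splits into disjoint
  -- nonempty open slices, one for each `i`.
  have hC : IsClosed {p : X × ULift.{u} Z | Φ p.1 = (q p).1} :=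
    isClosed_eq (hΦ.comp continuous_fst) hq.fst
  obtain ⟨t, htc, ht⟩ := hC.isLindelof.elim_countable_subcover
    (fun i : I => {p | (q p).2 = (i : OnePoint I)})
    (fun i => by
      have : IsOpen {(i : OnePoint I)} := by
        simpa using OnePoint.isOpen_image_coe.2 (isOpen_discrete {i})
      exact this.preimage hq.snd)
    (by
      rintro ⟨a, ⟨⟨z, ⟨k, hk, rfl⟩ | ⟨i, rfl⟩⟩⟩⟩ hp
      · exact (hΦE a (by rw [show Φ a = k from hp]; exact hk)).elim
      · exact mem_iUnion.2 ⟨i, rfl⟩)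
  refine countable_univ_iff.1 (htc.mono fun i _ => ?_)
  let p : X × ULift.{u} Z := (x i, ⟨(Φ (x i), (i : OnePoint I)), Or.inr ⟨i, rfl⟩⟩)
  obtain ⟨j, hj, hij⟩ := mem_iUnion₂.1 (ht (show p ∈ _ from rfl))
  rwa [OnePoint.coe_injective (show (i : OnePoint I) = j from hij)]

/-! ### From productively Lindelöf to Menger under CH -/

theorem ProductivelyLindelof.lindelofSpace {X : Type u} [TopologicalSpace X]
    (hX : ProductivelyLindelof X) : LindelofSpace X :=
  have := hX PUnit
  LindelofSpace.of_continuous_surjective (f := (Prod.fst : X × PUnit.{u + 1} → X)) continuous_fst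
    Prod.fst_surjective

/-- Under CH, `ℕ → ℕ` is enumerated by `ω₁`. -/
theorem exists_enumeration_of_CH (CH : Cardinal.aleph.{0} 1 = Cardinal.continuum.{0}) :
    ∃ (I : Type) (_ : LinearOrder I) (_ : I ≃ (ℕ → ℕ)), ∀ i : I, (Iic i).Countable := by
  have hcard : Cardinal.mk (Cardinal.aleph.{0} 1).ord.ToType = Cardinal.mk (ℕ → ℕ) := by
    rw [Cardinal.mk_ord_toType, CH]; simp
  refine ⟨_, inferInstance, (Cardinal.eq.1 hcard).some, fun i => ?_⟩
  have hlt : Cardinal.mk (Iio i) < Cardinal.aleph 1 := by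
    simpa using Cardinal.mk_Iio_lt i (by simp)
  have hle : Cardinal.mk (Iio i) ≤ Cardinal.aleph0 :=
    Order.lt_succ_iff.1 (hlt.trans_eq Cardinal.succ_aleph0.symm)
  rw [← Iio_insert]
  exact (Cardinal.le_aleph0_iff_set_countable.1 hle).insert i

/-- The points of the cube whose `n`-th row, for every `n`, has an entry other than `1` at some
place `k ≤ b n`. -/
def boundedRows (b : ℕ → ℕ) : Set (ℕ × ℕ → unitInterval) := {z | ∀ n, ∃ k ≤ b n, z (n, k) ≠ 1}

theorem IsCompact.exists_subset_boundedRows {C : Set (ℕ × ℕ → unitInterval)} (hC : IsCompact C)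
    (hCG : ∀ z ∈ C, ∀ n, ∃ k, z (n, k) ≠ 1) : ∃ b, C ⊆ boundedRows b := by
  have hb : ∀ n, ∃ b, ∀ z ∈ C, ∃ k ≤ b, z (n, k) ≠ 1 := by
    intro n
    obtain ⟨t, ht⟩ := hC.elim_finite_subcover
      (fun k : ℕ => {z : ℕ × ℕ → unitInterval | z (n, k) ≠ 1})
      (fun k => isOpen_ne_fun (continuous_apply _) continuous_const)
      fun z hz => mem_iUnion.2 (hCG z hz n)
    obtain ⟨b, hb⟩ := t.bddAbove
    refine ⟨b, fun z hz => ?_⟩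
    obtain ⟨k, hk, hzk⟩ := mem_iUnion₂.1 (ht hz)
    exact ⟨k, hb hk, hzk⟩
  choose b hb using hb
  exact ⟨b, fun z hz n => hb n z hz⟩

/-- In a Lindelöf regular space, a sequence of open covers is refined by countable cozero covers. -/
theorem exists_cozero_refinement {X : Type u} [TopologicalSpace X] [T3Space X] [LindelofSpace X]
    [Nonempty X] {𝒰 : ℕ → Set (Set X)} (h𝒰 : ∀ n, IsOpenCovering (𝒰 n)) :
    ∃ (Φ : X → ℕ × ℕ → unitInterval) (U : ℕ → ℕ → Set X), Continuous Φ ∧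
      (∀ n k, U n k ∈ 𝒰 n) ∧ (∀ n k x, Φ x (n, k) ≠ 1 → x ∈ U n k) ∧
      ∀ x n, ∃ k, Φ x (n, k) ≠ 1 := by
  have hrow : ∀ n, ∃ (φ : ℕ → X → unitInterval) (U : ℕ → Set X), (∀ k, Continuous (φ k)) ∧
      (∀ k, U k ∈ 𝒰 n) ∧ (∀ k x, φ k x ≠ 1 → x ∈ U k) ∧ ∀ x, ∃ k, φ k x ≠ 1 := by
    intro n
    have hpt : ∀ x, ∃ (U : Set X) (f : X → unitInterval), U ∈ 𝒰 n ∧ Continuous f ∧ f x = 0 ∧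
        ∀ y, f y ≠ 1 → y ∈ U := by
      intro x
      obtain ⟨U, hU, hxU⟩ := (h𝒰 n).2.ge (mem_univ x)
      obtain ⟨f, hf, hfx, hfU⟩ := CompletelyRegularSpace.completely_regular x Uᶜ
        ((h𝒰 n).1 U hU).isClosed_compl (by simpa using hxU)
      exact ⟨U, f, hU, hf, hfx, fun y hy => by_contra fun h => hy (hfU h)⟩
    choose U f hU hf hfx hfU using hpt
    obtain ⟨t, htc, ht⟩ := LindelofSpace.elim_nhds_subcover (fun x => {y | f x y ≠ 1}) fun x =>
      (isOpen_ne_fun (hf x) continuous_const).mem_nhds (by simp [hfx])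
    have htne : t.Nonempty := by
      by_contra h
      rw [not_nonempty_iff_eq_empty] at h
      simp only [h, mem_empty_iff_false, iUnion_of_empty, iUnion_empty] at ht
      exact empty_ne_univ ht
    obtain ⟨a, rfl⟩ := htc.exists_eq_range htne
    refine ⟨fun k => f (a k), fun k => U (a k), fun k => hf _, fun k => hU _, fun k => hfU _,
      fun x => ?_⟩
    simpa using ht.ge (mem_univ x)
  choose φ U hφ hU hφU hcov using hrow
  exact ⟨fun x p => φ p.1 p.2 x, U, continuous_pi fun p => hφ _ _, hU, hφU, fun x n => hcov n x⟩

/-- Diagonal choice: a point obeying the `i`-th bound is caught in row `i`. -/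
theorem exists_finite_selection_of_subset {X : Type u} {𝒰 : ℕ → Set (Set X)}
    {Φ : X → ℕ × ℕ → unitInterval} {U : ℕ → ℕ → Set X} (hU : ∀ n k, U n k ∈ 𝒰 n)
    (hΦU : ∀ n k x, Φ x (n, k) ≠ 1 → x ∈ U n k) (b : ℕ → ℕ → ℕ)
    (hb : ∀ x, ∃ i, Φ x ∈ boundedRows (b i)) :
    ∃ 𝒱 : ℕ → Set (Set X), (∀ n, 𝒱 n ⊆ 𝒰 n ∧ (𝒱 n).Finite) ∧ ⋃₀ (⋃ n, 𝒱 n) = univ := by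
  refine ⟨fun n => U n '' Iic (b n n), fun n => ⟨?_, (finite_Iic _).image _⟩,
    eq_univ_of_forall fun x => ?_⟩
  · rintro _ ⟨k, -, rfl⟩
    exact hU n k
  · obtain ⟨i, hi⟩ := hb x
    obtain ⟨k, hk, hxk⟩ := hi i
    exact ⟨U i k, mem_iUnion.2 ⟨i, mem_image_of_mem _ hk⟩, hΦU i k x hxk⟩

theorem ProductivelyLindelof.isMengerSpace (CH : Cardinal.aleph.{0} 1 = Cardinal.continuum.{0})
    {X : Type u} [TopologicalSpace X] [T3Space X] (hX : ProductivelyLindelof X) :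
    IsMengerSpace X := by
  intro 𝒰 h𝒰
  have := hX.lindelofSpace
  rcases isEmpty_or_nonempty X with hempty | hne
  · exact ⟨fun _ => ∅, by simp, Subsingleton.elim _ _⟩
  obtain ⟨Φ, U, hΦ, hU, hΦU, hcov⟩ := exists_cozero_refinement h𝒰
  by_contra hsel
  obtain ⟨I, _, e, hI⟩ := exists_enumeration_of_CH CH
  have hx : ∀ i : I, ∃ x, ∀ j ≤ i, Φ x ∉ boundedRows (e j) := by
    intro i
    by_contra! h
    obtain ⟨a, ha⟩ := (hI i).exists_eq_range ⟨i, self_mem_Iic⟩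
    refine hsel (exists_finite_selection_of_subset hU hΦU (fun n => e (a n)) fun x => ?_)
    obtain ⟨j, hj, hxj⟩ := h x
    obtain ⟨n, rfl⟩ := ha.le hj
    exact ⟨n, hxj⟩
  choose x hx using hx
  let _ : TopologicalSpace I := ⊥
  have : DiscreteTopology I := ⟨rfl⟩
  have hcount : Countable I := by
    refine countable_of_productivelyLindelof hX (E := {z | ¬ ∀ n, ∃ k, z (n, k) ≠ 1}) hΦ
      (fun a h => h (hcov a)) x fun O hO hEO => ?_
    -- The complement of `O` is a compact set inside one `boundedRows (e j)`, which `Φ (x i)` avoids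
    -- once `j ≤ i`.
    obtain ⟨b, hb⟩ := hO.isClosed_compl.isCompact.exists_subset_boundedRows fun z hz =>
      by_contra fun h => hz (hEO h)
    obtain ⟨j, rfl⟩ := e.surjective b
    refine (hI j).mono fun i hi => ?_
    by_contra hij
    exact hx i j (not_le.1 hij).le (hb hi)
  have hle := Cardinal.mk_le_aleph0_iff.2 (e.symm.injective.countable)
  simp only [Cardinal.mk_pi, Cardinal.mk_nat, Cardinal.prod_const, Cardinal.lift_id,
    Cardinal.aleph0_power_aleph0] at hle
  exact hle.not_gt Cardinal.aleph0_lt_continuum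

theorem mainTheorem2 (CH : Cardinal.aleph.{0} 1 = Cardinal.continuum.{0})
    (X : Type u) [TopologicalSpace X] [T3Space X] (hX : ProductivelyLindelof X) :
    IsMengerSpace X ∧ IsDSpace X := by
  have := hX.lindelofSpace
  have hM := hX.isMengerSpace CH
  exact ⟨hM, hM.isDSpace⟩
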